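/- Let $\mathbb{M}=(M_p)_{p\ge 0}$ be a weight sequence, i.e. a sequence of positive reals with $M_0=1$, $M_{p}^2\le M_{p-1}M_{p+1}$ for $p\ge 1$, and $m_p:=M_{p+1}/M_p\to\infty$. Put $$\gamma(\mathbb{M})=\sup\{\gamma>0:\ \exists a>0\ \forall q\ge p\ge 0,\ m_p/(p+1)^\gamma\le a\,m_q/(q+1)^\gamma\}\in[0,\infty]$$ (with $\sup\emptyset=0$), $\omega_{\mathbb{M}}(t)=\sup_{p\ge0}\ln(t^p/M_p)$ for $t>0$, $\omega_{\mathbb{M}}(0)=0$, and $h_{\mathbb{M}}(t)=\inf_{p\ge0}M_pt^p$ for $t>0$. Suppose $\gamma(\mathbb{M})>1$. Then $\int_1^\infty\omega_{\mathbb{M}}(t)t^{-2}\,dt<\infty$, so that the Poisson extension $$P(x+iy)=\frac{y}{\pi}\int_{-\infty}^{\infty}\frac{\omega_{\mathbb{M}}(|t|)}{(t-x)^2+y^2}\,dt,\qquad x\in\mathbb{R},\ y>0,$$ is well defined. It has a harmonic conjugate $Q$ in the open upper half-plane (a real function $Q$ such that $P+iQ$ is holomorphic there) normalized by $Q(i)=0$.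 For this $Q$, the function $$G(z)=\exp\bigl(-P(i/z)-iQ(i/z)\bigr)$$ is an optimal $\{\mathbb{M}\}$-flat function in the half-plane $S_1=\{z\in\mathbb{C}: z\ne0,\ |\arg z|<\pi/2\}$; that is, $G$ is holomorphic in $S_1$, there exist $K_1,K_2>0$ such that $G(x)$ is real and $K_1h_{\mathbb{M}}(K_2x)\le G(x)$ for all $x>0$, and there exist $K_3,K_4>0$ such that $|G(z)|\le K_3h_{\mathbb{M}}(K_4|z|)$ for all $z\in S_1$. -/

import Mathlib

noncomputable section

namespace OptimalFlat

/-- The sequence of quotients `m_p = M_{p+1} / M_p`. -/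
def quotient (M : ℕ → ℝ) (p : ℕ) : ℝ := M (p + 1) / M p

/-- Weight sequences: positive, normalized, logarithmically convex, with quotients tending
to infinity. -/
structure IsWeightSequence (M : ℕ → ℝ) : Prop where
  pos : ∀ p, 0 < M p
  zero : M 0 = 1
  logConvex : ∀ p, M (p + 1) ^ 2 ≤ M p * M (p + 2)
  tendsto_quotient : Filter.Tendsto (quotient M) Filter.atTop Filter.atTop

/-- Almost increasing sequences. -/
def AlmostIncreasing (c : ℕ → ℝ) : Prop :=
  ∃ a : ℝ, 0 < a ∧ ∀ p q : ℕ, p ≤ q → c p ≤ a * c q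

/-- The index `γ(M) ∈ [0, ∞]`: the supremum of all `γ > 0` such that
`m_p / (p + 1) ^ γ` is almost increasing (and `0` if there is no such `γ`). -/
def gammaIndex (M : ℕ → ℝ) : ENNReal :=
  sSup (ENNReal.ofReal ''
    {γ : ℝ | 0 < γ ∧ AlmostIncreasing fun p => quotient M p / ((p : ℝ) + 1) ^ γ})

/-- The associated function `ω_M`, used for `t ≥ 0`. -/
def omega (M : ℕ → ℝ) (t : ℝ) : ℝ :=
  if t = 0 then 0 else ⨆ p : ℕ, Real.log (t ^ p / M p)

/-- The associated function `h_M`, used for `t > 0`. -/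
def h (M : ℕ → ℝ) (t : ℝ) : ℝ := ⨅ p : ℕ, M p * t ^ p

/-- Nonquasianalyticity of a function on `[0, ∞)`. -/
def IsNonquasianalytic (σ : ℝ → ℝ) : Prop :=
  MeasureTheory.IntegrableOn (fun t : ℝ => σ t / t ^ 2) (Set.Ioi 1)

/-- The harmonic (Poisson) extension `P_σ` of `x ↦ σ |x|` to the complex plane. -/
def harmonicExtension (σ : ℝ → ℝ) (z : ℂ) : ℝ :=
  if z.im = 0 then σ |z.re|
  else |z.im| / Real.pi * ∫ t : ℝ, σ |t| / ((t - z.re) ^ 2 + z.im ^ 2)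

/-- The open upper half-plane, as a subset of `ℂ`. -/
def upperHalf : Set ℂ := {z | 0 < z.im}

/-- `Q` is a harmonic conjugate of `P` in the open set `U`: `P + i Q` is holomorphic in `U`. -/
def IsHarmonicConjugateOn (P Q : ℂ → ℝ) (U : Set ℂ) : Prop :=
  DifferentiableOn ℂ (fun w => (P w : ℂ) + Complex.I * (Q w : ℂ)) U

/-- The unbounded sector `S_γ` bisected by the positive real line with opening `γ π`,
for `0 < γ ≤ 2`, as a subset of `ℂ`. -/
def sector (γ : ℝ) : Set ℂ := {z | z ≠ 0 ∧ |z.arg| < γ * Real.pi / 2}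

/-- Optimal `{M}`-flat functions in a sector `S` bisected by the positive real line.
The inequality `K₁ h_M (K₂ x) ≤ G x` includes that `G x` is real. -/
structure IsOptimalFlat (M : ℕ → ℝ) (S : Set ℂ) (G : ℂ → ℂ) : Prop where
  holomorphic : DifferentiableOn ℂ G S
  lower : ∃ K₁ K₂ : ℝ, 0 < K₁ ∧ 0 < K₂ ∧ ∀ x : ℝ, 0 < x →
    (G x).im = 0 ∧ K₁ * h M (K₂ * x) ≤ (G x).re
  upper : ∃ K₃ K₄ : ℝ, 0 < K₃ ∧ 0 < K₄ ∧ ∀ z ∈ S, ‖G z‖ ≤ K₃ * h M (K₄ * ‖z‖)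

/-- `G(z) = exp(-P(i/z) - i Q(i/z))` with `P` the harmonic extension of `ω_M`. -/
def flatFun (M : ℕ → ℝ) (Q : ℂ → ℝ) (z : ℂ) : ℂ :=
  Complex.exp (-(harmonicExtension (omega M) (Complex.I / z) : ℂ)
    - Complex.I * (Q (Complex.I / z) : ℂ))

end OptimalFlat

end

noncomputable section

namespace OptimalFlat

open MeasureTheory Real

/-! Since `‖G z‖ = exp (-P (I / z))` and `exp (-logTerm M p t) = M p * t⁻¹ ^ p`, both flatness
bounds compare `P` with single terms `p log t - log M_p`. An error linear in `p` is harmless: after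
exponentiation it is a dilation of the argument of `h`, so no moderate growth of `M` is needed.

Lower bound for `G` (`exists_harmonicExtension_le_logTerm`): given `y`, let `q` be the first index
with `m_q > y`. If `m_p / (p + 1) ^ γ` is almost increasing for some `γ > 1`, the quotients after
`q` grow fast enough that all terms at `y * s` stay below the `q`-th term at `y` plus `C (q + 1) s ^
β`, with `β < 1` (`exists_logTerm_growth`). The Poisson integral of a power below one converges and
scales, so `P (i y)` exceeds that term by at most `C' (q + 1)`. The same growth estimate makes `ω`
nonquasianalytic.

Upper bound for `G` (`logTerm_sub_le_harmonicExtension`): `ω` dominates every term, and the Poisson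
integral of `log |t|` at `z` is at least `log ‖z‖` minus a constant.

The conjugate is the imaginary part of an explicit Schwarz integral, which is real on the imaginary
axis. Any other admissible `Q` gives the same exponential, so `G` is real on the positive axis. -/

/-- The logarithm of `t ^ p / M p`, for `t > 0`. -/
def logTerm (M : ℕ → ℝ) (p : ℕ) (t : ℝ) : ℝ := p * log t - log (M p)

/-! ### Terms and their increments -/

theorem quotient_pos {M : ℕ → ℝ} (hM : ∀ p, 0 < M p) (p : ℕ) : 0 < quotient M p :=
  div_pos (hM _) (hM _)

theorem logTerm_eq_log {M : ℕ → ℝ} (hM : ∀ p, 0 < M p) (p : ℕ) {t : ℝ} (ht : 0 < t) :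
    logTerm M p t = log (t ^ p / M p) := by
  rw [logTerm, log_div (pow_pos ht p).ne' (hM p).ne', log_pow]

theorem logTerm_succ {M : ℕ → ℝ} (hM : ∀ p, 0 < M p) (p : ℕ) {t : ℝ} (ht : 0 < t) :
    logTerm M (p + 1) t = logTerm M p t + log (t / quotient M p) := by
  rw [log_div ht.ne' (quotient_pos hM p).ne', quotient, log_div (hM _).ne' (hM _).ne', logTerm,
    logTerm]
  push_cast
  ring

theorem logTerm_add {M : ℕ → ℝ} (hM : ∀ p, 0 < M p) (q n : ℕ) {t : ℝ} (ht : 0 < t) :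
    logTerm M (q + n) t =
      logTerm M q t + ∑ j ∈ Finset.range n, log (t / quotient M (q + j)) := by
  induction n with
  | zero => simp
  | succ n ih => rw [← add_assoc, logTerm_succ hM _ ht, ih, Finset.sum_range_succ, add_assoc]

theorem logTerm_mul {M : ℕ → ℝ} (p : ℕ) {t s : ℝ} (ht : 0 < t) (hs : 0 < s) :
    logTerm M p (t * s) = logTerm M p t + p * log s := by
  rw [logTerm, logTerm, log_mul ht.ne' hs.ne']
  ring

theorem exp_neg_logTerm {M : ℕ → ℝ} (hM : ∀ p, 0 < M p) (p : ℕ) {t : ℝ} (ht : 0 < t) :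
    exp (-logTerm M p t) = M p * t⁻¹ ^ p := by
  rw [logTerm_eq_log hM p ht, exp_neg, exp_log (div_pos (pow_pos ht p) (hM p)), inv_div, inv_pow]
  rfl

/-! ### Tail sums of negative powers -/

/-- Discrete counterpart of integrating `κ u ^ (-1 - κ)` over `[x, x + 1]`; it makes the tail sums
telescope. -/
theorem mul_rpow_neg_le_sub {κ x : ℝ} (hκ : 0 < κ) (hx : 0 < x) :
    κ * (x + 1) ^ (-(1 + κ)) ≤ x ^ (-κ) - (x + 1) ^ (-κ) := by
  have h1 : 0 < x + 1 := by linarith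
  have hu : 0 < x / (x + 1) := div_pos hx h1
  have hlog : log (x / (x + 1)) ≤ -(1 / (x + 1)) := by
    refine (log_le_sub_one_of_pos hu).trans (le_of_eq ?_)
    field_simp
    ring
  have hb : 1 + κ / (x + 1) ≤ (x / (x + 1)) ^ (-κ) := by
    rw [rpow_def_of_pos hu]
    have h2 : κ / (x + 1) ≤ log (x / (x + 1)) * -κ := by
      have := mul_le_mul_of_nonneg_right hlog hκ.le
      have e : -(1 / (x + 1)) * κ = -(κ / (x + 1)) := by ring
      linarith
    linarith [add_one_le_exp (log (x / (x + 1)) * -κ)]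
  have e1 : x ^ (-κ) = (x + 1) ^ (-κ) * (x / (x + 1)) ^ (-κ) := by
    rw [← mul_rpow h1.le hu.le, mul_div_cancel₀ _ h1.ne']
  have e2 : (x + 1) ^ (-(1 + κ)) = (x + 1) ^ (-κ) / (x + 1) := by
    rw [← rpow_sub_one h1.ne']
    congr 1
    ring
  rw [e1, e2]
  have := mul_le_mul_of_nonneg_left hb (rpow_pos_of_pos h1 (-κ)).le
  have e3 : κ * ((x + 1) ^ (-κ) / (x + 1)) = (x + 1) ^ (-κ) * (κ / (x + 1)) := by ring
  linarith

theorem sum_rpow_neg_le {κ : ℝ} (hκ : 0 < κ) (q n : ℕ) :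
    ∑ j ∈ Finset.range n, (((q + j : ℕ) : ℝ) + 1) ^ (-(1 + κ)) ≤
      (1 + 1 / κ) * ((q : ℝ) + 1) ^ (-κ) := by
  have hq : (1 : ℝ) ≤ (q : ℝ) + 1 := by linarith [q.cast_nonneg (α := ℝ)]
  -- The first summand is kept apart and the others telescope; this is the source of the two parts
  -- of `1 + 1 / κ`.
  have key : ∀ n : ℕ, ∑ j ∈ Finset.range (n + 1), (((q + j : ℕ) : ℝ) + 1) ^ (-(1 + κ)) ≤
      ((q : ℝ) + 1) ^ (-(1 + κ)) +
        1 / κ * (((q : ℝ) + 1) ^ (-κ) - (((q + n : ℕ) : ℝ) + 1) ^ (-κ)) := by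
    intro n
    induction n with
    | zero => simp
    | succ n ih =>
      rw [Finset.sum_range_succ]
      have h := mul_rpow_neg_le_sub hκ (x := ((q + n : ℕ) : ℝ) + 1) (by positivity)
      have e : ((q + (n + 1) : ℕ) : ℝ) + 1 = ((q + n : ℕ) : ℝ) + 1 + 1 := by push_cast; ring
      rw [e]
      have h' := mul_le_mul_of_nonneg_left h (one_div_pos.2 hκ).le
      rw [← mul_assoc, one_div_mul_cancel hκ.ne', one_mul] at h'
      linarith
  have h0 : ((q : ℝ) + 1) ^ (-(1 + κ)) ≤ ((q : ℝ) + 1) ^ (-κ) :=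
    rpow_le_rpow_of_exponent_le hq (by linarith)
  cases n with
  | zero =>
    simp only [Finset.range_zero, Finset.sum_empty]
    positivity
  | succ n =>
    have h1 : 0 ≤ 1 / κ * (((q + n : ℕ) : ℝ) + 1) ^ (-κ) := by positivity
    linarith [key n]

/-! ### Growth estimate for the terms -/

theorem exists_almostIncreasing_of_one_lt {M : ℕ → ℝ} (hγ : 1 < gammaIndex M) :
    ∃ γ : ℝ, 1 < γ ∧ AlmostIncreasing fun p => quotient M p / ((p : ℝ) + 1) ^ γ := by
  obtain ⟨_, ⟨γ, hγ', rfl⟩, h⟩ := lt_sSup_iff.1 hγ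
  exact ⟨γ, by simpa using ENNReal.one_lt_ofReal.1 h, hγ'.2⟩

theorem exists_quotient_gt {M : ℕ → ℝ} (hM : IsWeightSequence M) (y : ℝ) :
    ∃ q, y < quotient M q ∧ ∀ j < q, quotient M j ≤ y := by
  classical
  have h : ∃ q, y < quotient M q :=
    (hM.tendsto_quotient.eventually_gt_atTop y).exists
  exact ⟨Nat.find h, Nat.find_spec h, fun j hj => not_lt.1 (Nat.find_min h hj)⟩

theorem logTerm_le_of_quotient_le {M : ℕ → ℝ} (hM : ∀ p, 0 < M p) {y : ℝ} (hy : 0 < y) {p q : ℕ}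
    (hpq : p ≤ q) (h : ∀ j < q, quotient M j ≤ y) : logTerm M p y ≤ logTerm M q y := by
  obtain ⟨n, rfl⟩ := Nat.exists_eq_add_of_le hpq
  rw [logTerm_add hM p n hy]
  refine le_add_of_nonneg_right (Finset.sum_nonneg fun j hj => log_nonneg ?_)
  rw [le_div_iff₀ (quotient_pos hM _), one_mul]
  exact h _ (by have := Finset.mem_range.1 hj; omega)

/-- The fundamental growth estimate: for each `y > 0` the terms at `y * s` exceed a single term at
`y` by at most a sublinear power of `s`, with a constant proportional to the index of that term. -/
theorem exists_logTerm_growth {M : ℕ → ℝ} (hM : IsWeightSequence M) (hγ : 1 < gammaIndex M) :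
    ∃ β C : ℝ, 0 < β ∧ β < 1 ∧ 0 < C ∧ ∀ y : ℝ, 0 < y → ∃ q : ℕ, ∀ p : ℕ, ∀ s : ℝ, 1 ≤ s →
      logTerm M p (y * s) ≤ logTerm M q y + C * ((q : ℝ) + 1) * s ^ β := by
  obtain ⟨γ, hγ1, a, ha, hinc⟩ := exists_almostIncreasing_of_one_lt hγ
  obtain ⟨β, κ, hβ, hβ1, hκ, hδ⟩ :
      ∃ β κ : ℝ, 0 < β ∧ β < 1 ∧ 0 < κ ∧ γ * β = 1 + κ := by
    -- `β` is the midpoint of `1 / γ` and `1`, so that `γ β > 1` makes the series summable while `β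
    -- < 1` keeps the growth sublinear.
    refine ⟨(1 + 1 / γ) / 2, (γ - 1) / 2, by positivity, ?_, by linarith, ?_⟩
    · have : 1 / γ < 1 := by rw [div_lt_one (by linarith)]; exact hγ1
      linarith
    · have : γ ≠ 0 := by positivity
      field_simp
      ring
  refine ⟨β, 1 / β * (1 + a ^ β * (1 + 1 / κ)), hβ, hβ1, by positivity, fun y hy => ?_⟩
  obtain ⟨q, hq, hlt⟩ := exists_quotient_gt hM y
  refine ⟨q, fun p s hs => ?_⟩
  have hs0 : 0 < s := by linarith
  have hlog0 : 0 ≤ log s := log_nonneg hs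
  have hlog : log s ≤ 1 / β * s ^ β := by
    rw [one_div_mul_eq_div]
    exact log_le_rpow_div hs0.le hβ
  have hq1 : (0 : ℝ) < (q : ℝ) + 1 := by positivity
  have hsβ : 0 < s ^ β := rpow_pos_of_pos hs0 β
  have hqlog : (q : ℝ) * log s ≤ 1 / β * ((q : ℝ) + 1) * s ^ β := by
    have := mul_le_mul_of_nonneg_left hlog hq1.le
    nlinarith
  have hsplit : 1 / β * (1 + a ^ β * (1 + 1 / κ)) * ((q : ℝ) + 1) * s ^ β =
      1 / β * ((q : ℝ) + 1) * s ^ β +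
        1 / β * (s ^ β * a ^ β * ((1 + 1 / κ) * ((q : ℝ) + 1))) := by ring
  have hrest : 0 ≤ 1 / β * (s ^ β * a ^ β * ((1 + 1 / κ) * ((q : ℝ) + 1))) := by positivity
  rw [hsplit]
  -- Below `q` the increments at `y` are nonnegative, so only `p log s ≤ q log s` is lost. Beyond
  -- `q` the extra increments are bounded through `log x ≤ x ^ β / β` and summed.
  rcases le_total p q with hpq | hpq
  · have h1 := logTerm_le_of_quotient_le hM.pos hy hpq hlt
    have h2 : (p : ℝ) * log s ≤ q * log s :=
      mul_le_mul_of_nonneg_right (Nat.cast_le.2 hpq) hlog0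
    rw [logTerm_mul p hy hs0]
    linarith
  · obtain ⟨n, rfl⟩ := Nat.exists_eq_add_of_le hpq
    rw [logTerm_add hM.pos q n (mul_pos hy hs0), logTerm_mul q hy hs0]
    have hterm : ∀ j ∈ Finset.range n, log (y * s / quotient M (q + j)) ≤
        1 / β * (s ^ β * a ^ β * ((q : ℝ) + 1) ^ (1 + κ)) *
          (((q + j : ℕ) : ℝ) + 1) ^ (-(1 + κ)) := by
      intro j _
      have hm := quotient_pos hM.pos (q + j)
      have hj1 : (0 : ℝ) < ((q + j : ℕ) : ℝ) + 1 := by positivity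
      refine (log_le_rpow_div (by positivity) hβ).trans ?_
      have h1 : y * s / quotient M (q + j) ≤
          s * (a * ((q : ℝ) + 1) ^ γ * (((q + j : ℕ) : ℝ) + 1) ^ (-γ)) := by
        have h2 := hinc q (q + j) (Nat.le_add_right _ _)
        have h3 : quotient M q ≤
            a * ((q : ℝ) + 1) ^ γ * (((q + j : ℕ) : ℝ) + 1) ^ (-γ) * quotient M (q + j) := by
          rw [div_le_iff₀ (rpow_pos_of_pos hq1 γ)] at h2
          refine h2.trans (le_of_eq ?_)
          rw [rpow_neg hj1.le]
          ring
        rw [div_le_iff₀ hm]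
        calc y * s ≤ quotient M q * s := mul_le_mul_of_nonneg_right hq.le hs0.le
          _ ≤ _ := mul_le_mul_of_nonneg_right h3 hs0.le
          _ = _ := by ring
      have h4 := rpow_le_rpow (by positivity) h1 hβ.le
      have h5 : (s * (a * ((q : ℝ) + 1) ^ γ * (((q + j : ℕ) : ℝ) + 1) ^ (-γ))) ^ β =
          s ^ β * a ^ β * ((q : ℝ) + 1) ^ (1 + κ) * (((q + j : ℕ) : ℝ) + 1) ^ (-(1 + κ)) := by
        rw [mul_rpow hs0.le (by positivity), mul_rpow (by positivity) (by positivity),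
          mul_rpow ha.le (by positivity), ← rpow_mul hq1.le, ← rpow_mul hj1.le, neg_mul, hδ]
        ring
      rw [h5] at h4
      rw [div_eq_inv_mul, ← one_div]
      have := mul_le_mul_of_nonneg_left h4 (one_div_pos.2 hβ).le
      linarith
    have hsum := Finset.sum_le_sum hterm
    rw [← Finset.mul_sum] at hsum
    have hfin := mul_le_mul_of_nonneg_left (sum_rpow_neg_le hκ q n)
      (show 0 ≤ 1 / β * (s ^ β * a ^ β * ((q : ℝ) + 1) ^ (1 + κ)) by positivity)
    have hpow : ((q : ℝ) + 1) ^ (1 + κ) * ((q : ℝ) + 1) ^ (-κ) = (q : ℝ) + 1 := by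
      rw [← rpow_add hq1]
      simp
    have e : 1 / β * (s ^ β * a ^ β * ((q : ℝ) + 1) ^ (1 + κ)) *
        ((1 + 1 / κ) * ((q : ℝ) + 1) ^ (-κ)) =
        1 / β * (s ^ β * a ^ β * ((1 + 1 / κ) * ((q : ℝ) + 1))) := by
      rw [show 1 / β * (s ^ β * a ^ β * ((q : ℝ) + 1) ^ (1 + κ)) *
          ((1 + 1 / κ) * ((q : ℝ) + 1) ^ (-κ)) =
          1 / β * (s ^ β * a ^ β * ((1 + 1 / κ) *
            (((q : ℝ) + 1) ^ (1 + κ) * ((q : ℝ) + 1) ^ (-κ)))) by ring, hpow]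
    linarith

/-! ### Growth and integrability of the associated function -/

theorem measurable_omega (M : ℕ → ℝ) : Measurable (omega M) := by
  refine Measurable.ite (measurableSet_singleton 0) measurable_const ?_
  exact Measurable.iSup fun p => Real.measurable_log.comp ((measurable_id.pow_const p).div_const _)

theorem logTerm_mono {M : ℕ → ℝ} (p : ℕ) {s t : ℝ} (hs : 0 < s) (hst : s ≤ t) :
    logTerm M p s ≤ logTerm M p t :=
  sub_le_sub_right (mul_le_mul_of_nonneg_left (log_le_log hs hst) p.cast_nonneg) _

theorem logTerm_zero {M : ℕ → ℝ} (hM : M 0 = 1) (t : ℝ) : logTerm M 0 t = 0 := by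
  simp [logTerm, hM]

theorem logTerm_le_omega {M : ℕ → ℝ} (hM : IsWeightSequence M) (hγ : 1 < gammaIndex M) (p : ℕ)
    {t : ℝ} (ht : 0 < t) : logTerm M p t ≤ omega M t := by
  obtain ⟨β, C, -, -, -, h⟩ := exists_logTerm_growth hM hγ
  obtain ⟨q, hq⟩ := h t ht
  rw [omega, if_neg ht.ne', logTerm_eq_log hM.pos p ht]
  -- The growth estimate at `s = 1` bounds the terms above, so the real supremum is not the default
  -- value `0`.
  refine le_ciSup (f := fun p => log (t ^ p / M p)) 
    ⟨logTerm M q t + C * ((q : ℝ) + 1) * 1 ^ β, ?_⟩ p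
  rintro _ ⟨n, rfl⟩
  have := hq n 1 le_rfl
  rw [mul_one, logTerm_eq_log hM.pos n ht] at this
  exact this

theorem omega_nonneg {M : ℕ → ℝ} (hM : IsWeightSequence M) (hγ : 1 < gammaIndex M) {t : ℝ}
    (ht : 0 ≤ t) : 0 ≤ omega M t := by
  rcases ht.eq_or_lt with rfl | ht
  · simp [omega]
  · exact (logTerm_zero hM.zero t).symm.le.trans (logTerm_le_omega hM hγ 0 ht)

theorem exists_omega_growth {M : ℕ → ℝ} (hM : IsWeightSequence M) (hγ : 1 < gammaIndex M) :
    ∃ β C : ℝ, 0 < β ∧ β < 1 ∧ 0 < C ∧ ∀ y : ℝ, 0 < y → ∃ q : ℕ, ∀ t : ℝ, 0 ≤ t →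
      omega M t ≤ logTerm M q y + C * ((q : ℝ) + 1) * (1 + t / y) ^ β := by
  obtain ⟨β, C, hβ, hβ1, hC, h⟩ := exists_logTerm_growth hM hγ
  refine ⟨β, C, hβ, hβ1, hC, fun y hy => ?_⟩
  obtain ⟨q, hq⟩ := h y hy
  refine ⟨q, fun t ht => ?_⟩
  -- Dilating by `1 + t / y` rather than `t / y` keeps the factor at least `1`, so `t < y` is
  -- covered too.
  have hs : 1 ≤ 1 + t / y := le_add_of_nonneg_right (by positivity)
  rcases ht.eq_or_lt with rfl | ht
  · have := hq 0 _ hs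
    rw [logTerm_zero hM.zero] at this
    simpa [omega] using this
  · rw [omega, if_neg ht.ne']
    refine ciSup_le fun p => ?_
    rw [← logTerm_eq_log hM.pos p ht]
    refine (logTerm_mono p ht ?_).trans (hq p _ hs)
    rw [mul_add, mul_div_cancel₀ _ hy.ne']
    linarith

theorem integrable_one_add_abs_rpow {β : ℝ} (hβ : β < 1) :
    Integrable fun t : ℝ => (1 + |t|) ^ β / (1 + |t|) ^ 2 := by
  have h := integrable_one_add_norm (E := ℝ) (μ := volume) (r := 2 - β) (by simp; linarith)
  refine h.congr (Filter.Eventually.of_forall fun t => ?_)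
  have ht : 0 < 1 + |t| := by positivity
  simp only [norm_eq_abs]
  rw [← rpow_natCast (1 + |t|) 2, ← rpow_sub ht]
  congr 1
  push_cast
  ring

theorem integrable_omega_weighted {M : ℕ → ℝ} (hM : IsWeightSequence M) (hγ : 1 < gammaIndex M) :
    Integrable fun t : ℝ => omega M |t| / (1 + |t|) ^ 2 := by
  obtain ⟨β, C, hβ, hβ1, hC, h⟩ := exists_omega_growth hM hγ
  obtain ⟨q, hq⟩ := h 1 one_pos
  refine ((integrable_one_add_abs_rpow hβ1).const_mul (|logTerm M q 1| + C * ((q : ℝ) + 1))).mono'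
    ?_ (Filter.Eventually.of_forall fun t => ?_)
  · exact (((measurable_omega M).comp measurable_norm).div
      ((measurable_norm.const_add 1).pow_const 2)).aestronglyMeasurable
  · have h0 := omega_nonneg hM hγ (abs_nonneg t)
    have h1 : 1 ≤ (1 + |t|) ^ β := one_le_rpow (by linarith [abs_nonneg t]) hβ.le
    rw [norm_eq_abs, abs_of_nonneg (by positivity), ← mul_div_assoc]
    refine div_le_div_of_nonneg_right ?_ (by positivity)
    have h2 := hq |t| (abs_nonneg t)
    rw [div_one] at h2
    have h3 := le_mul_of_one_le_right (abs_nonneg (logTerm M q 1)) h1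
    linarith [le_abs_self (logTerm M q 1)]

theorem isNonquasianalytic_omega {M : ℕ → ℝ} (hM : IsWeightSequence M)
    (hγ : 1 < gammaIndex M) : IsNonquasianalytic (omega M) := by
  refine ((integrable_omega_weighted hM hγ).integrableOn.const_mul 4).mono' ?_ ?_
  · exact ((measurable_omega M).div (measurable_id.pow_const 2)).aestronglyMeasurable
  · refine (ae_restrict_mem measurableSet_Ioi).mono fun t ht => ?_
    have ht1 : 1 < t := ht
    have h0 := omega_nonneg hM hγ (by linarith : 0 ≤ t)
    rw [norm_eq_abs, abs_of_nonneg (by positivity), abs_of_pos (by linarith), ← mul_div_assoc,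
      div_le_div_iff₀ (by positivity) (by positivity)]
    have : (1 + t) ^ 2 ≤ 4 * t ^ 2 := by nlinarith
    nlinarith [mul_le_mul_of_nonneg_left this h0]

/-! ### The Schwarz integral and its real part -/

/-- The function `z ↦ (1 / (π i)) ∫ σ(t) z / (t² - z²) dt`, whose real part in the upper half-plane
is the Poisson integral of an even function `σ`. -/
def schwarzIntegral (σ : ℝ → ℝ) (z : ℂ) : ℂ :=
  -Complex.I / π * ∫ t : ℝ, (σ t : ℂ) * (z / ((t : ℂ) ^ 2 - z ^ 2))

/-- The constant depends only on `δ` and `R`, which gives one dominating function near each point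
when differentiating under the integral. -/
theorem mul_one_add_abs_le_norm_sub {δ R : ℝ} (hδ : 0 < δ) {z : ℂ} (hz : δ ≤ |z.im|)
    (hR : ‖z‖ ≤ R) (t : ℝ) : δ / (1 + R + δ) * (1 + |t|) ≤ ‖(t : ℂ) - z‖ := by
  have hR0 : 0 ≤ R := (norm_nonneg z).trans hR
  have h1 : δ ≤ ‖(t : ℂ) - z‖ := by
    refine hz.trans ?_
    simpa using Complex.abs_im_le_norm ((t : ℂ) - z)
  have h2 : |t| ≤ ‖(t : ℂ) - z‖ + R := by
    have := norm_sub_norm_le (t : ℂ) z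
    rw [Complex.norm_real, norm_eq_abs] at this
    linarith
  rw [div_mul_eq_mul_div, div_le_iff₀ (by positivity)]
  nlinarith [mul_le_mul_of_nonneg_left h2 hδ.le, mul_le_mul_of_nonneg_left h1 hR0]

theorem le_norm_sq_sub_sq {δ R : ℝ} (hδ : 0 < δ) {z : ℂ} (hz : δ ≤ |z.im|)
    (hR : ‖z‖ ≤ R) (t : ℝ) :
    (δ / (1 + R + δ)) ^ 2 * (1 + |t|) ^ 2 ≤ ‖(t : ℂ) ^ 2 - z ^ 2‖ := by
  have hR0 : 0 ≤ R := (norm_nonneg z).trans hR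
  have h1 := mul_one_add_abs_le_norm_sub hδ hz hR t
  have h2 := mul_one_add_abs_le_norm_sub hδ (z := -z) (by simpa using hz) (by simpa using hR) t
  rw [show (t : ℂ) ^ 2 - z ^ 2 = ((t : ℂ) - z) * ((t : ℂ) - -z) by ring, norm_mul, ← mul_pow, sq]
  exact mul_le_mul h1 h2 (by positivity) (norm_nonneg _)

theorem sq_sub_sq_ne_zero {z : ℂ} (hz : z.im ≠ 0) (t : ℝ) : (t : ℂ) ^ 2 - z ^ 2 ≠ 0 := by
  have h := le_norm_sq_sub_sq (abs_pos.2 hz) le_rfl le_rfl t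
  have hp : 0 < (|z.im| / (1 + ‖z‖ + |z.im|)) ^ 2 * (1 + |t|) ^ 2 := by
    have := abs_pos.2 hz
    positivity
  exact norm_pos_iff.1 (hp.trans_le h)

theorem integrable_mul_of_norm_le {σ : ℝ → ℝ} (hσ : Measurable σ)
    (hint : Integrable fun t => σ t / (1 + |t|) ^ 2) {k : ℝ → ℂ} (hk : Measurable k) {C : ℝ}
    (hC : ∀ t, ‖k t‖ ≤ C / (1 + |t|) ^ 2) : Integrable fun t => (σ t : ℂ) * k t := by
  refine (hint.norm.const_mul C).mono'
    ((Complex.measurable_ofReal.comp hσ).mul hk).aestronglyMeasurable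
    (Filter.Eventually.of_forall fun t => ?_)
  rw [norm_mul, Complex.norm_real, norm_div, norm_of_nonneg (by positivity : 0 ≤ (1 + |t|) ^ 2)]
  calc ‖σ t‖ * ‖k t‖ ≤ ‖σ t‖ * (C / (1 + |t|) ^ 2) :=
        mul_le_mul_of_nonneg_left (hC t) (norm_nonneg _)
    _ = _ := by ring

theorem integrable_schwarz_kernel {σ : ℝ → ℝ} (hσ : Measurable σ)
    (hint : Integrable fun t => σ t / (1 + |t|) ^ 2) {z : ℂ} (hz : z.im ≠ 0) :
    Integrable fun t : ℝ => (σ t : ℂ) * (z / ((t : ℂ) ^ 2 - z ^ 2)) := by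
  have hz' := abs_pos.2 hz
  set c := (|z.im| / (1 + ‖z‖ + |z.im|)) ^ 2 with hc
  have hc0 : 0 < c := by positivity
  refine integrable_mul_of_norm_le hσ hint (by fun_prop) (C := ‖z‖ / c) fun t => ?_
  rw [norm_div, div_div]
  exact div_le_div_of_nonneg_left (norm_nonneg _) (by positivity)
    (le_norm_sq_sub_sq hz' le_rfl le_rfl t)

theorem differentiableAt_schwarzIntegral {σ : ℝ → ℝ} (hσ : Measurable σ)
    (hint : Integrable fun t => σ t / (1 + |t|) ^ 2) {z₀ : ℂ} (hz₀ : 0 < z₀.im) :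
    DifferentiableAt ℂ (schwarzIntegral σ) z₀ := by
  set δ := z₀.im / 2 with hδ
  set R := ‖z₀‖ + δ with hR
  have hδ0 : 0 < δ := by positivity
  have hR0 : 0 ≤ R := by positivity
  set c := (δ / (1 + R + δ)) ^ 2 with hc
  have hc0 : 0 < c := by positivity
  have him : ∀ z ∈ Metric.ball z₀ δ, δ ≤ |z.im| := fun z hz => by
    have h1 := (Complex.abs_im_le_norm (z - z₀)).trans (mem_ball_iff_norm.1 hz).le
    rw [Complex.sub_im] at h1
    have := (abs_le.1 h1).1
    exact le_trans (by linarith) (le_abs_self z.im)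
  have hnorm : ∀ z ∈ Metric.ball z₀ δ, ‖z‖ ≤ R := fun z hz => by
    have h1 := (mem_ball_iff_norm.1 hz).le
    have h2 := norm_sub_norm_le z z₀
    linarith
  have hne : ∀ z ∈ Metric.ball z₀ δ, z.im ≠ 0 := fun z hz h => by
    have := him z hz
    rw [h, abs_zero] at this
    linarith
  have key := hasDerivAt_integral_of_dominated_loc_of_deriv_le (μ := volume)
    (F := fun (z : ℂ) (t : ℝ) => (σ t : ℂ) * (z / ((t : ℂ) ^ 2 - z ^ 2)))
    (F' := fun (z : ℂ) (t : ℝ) =>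
      (σ t : ℂ) * (((t : ℂ) ^ 2 + z ^ 2) / ((t : ℂ) ^ 2 - z ^ 2) ^ 2))
    (bound := fun t => (1 + R ^ 2) / c ^ 2 * ‖σ t / (1 + |t|) ^ 2‖)
    (Metric.ball_mem_nhds z₀ hδ0) (x₀ := z₀) ?_ ?_ ?_ ?_ ?_ ?_
  · exact (key.2.const_mul _).differentiableAt
  · exact Filter.Eventually.of_forall fun z =>
      ((Complex.measurable_ofReal.comp hσ).mul (by fun_prop)).aestronglyMeasurable
  · exact integrable_schwarz_kernel hσ hint hz₀.ne'
  · exact ((Complex.measurable_ofReal.comp hσ).mul (by fun_prop)).aestronglyMeasurable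
  · refine Filter.Eventually.of_forall fun t z hz => ?_
    have hw : 0 < (1 + |t|) ^ 2 := by positivity
    have h1 := le_norm_sq_sub_sq hδ0 (him z hz) (hnorm z hz) t
    have h2 : ‖(t : ℂ) ^ 2 + z ^ 2‖ ≤ (1 + R ^ 2) * (1 + |t|) ^ 2 := by
      refine (norm_add_le _ _).trans ?_
      rw [norm_pow, norm_pow, Complex.norm_real, norm_eq_abs]
      have h3 : ‖z‖ ^ 2 ≤ R ^ 2 := pow_le_pow_left₀ (norm_nonneg _) (hnorm z hz) 2
      nlinarith [abs_nonneg t, sq_nonneg R, mul_nonneg (sq_nonneg R) (abs_nonneg t),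
        mul_nonneg (sq_nonneg R) (sq_nonneg |t|)]
    rw [norm_mul, norm_div, norm_pow, Complex.norm_real, norm_div, norm_of_nonneg hw.le]
    have h4 : ‖(t : ℂ) ^ 2 + z ^ 2‖ / ‖(t : ℂ) ^ 2 - z ^ 2‖ ^ 2 ≤
        (1 + R ^ 2) * (1 + |t|) ^ 2 / (c * (1 + |t|) ^ 2) ^ 2 :=
      div_le_div₀ (by positivity) h2 (by positivity) (pow_le_pow_left₀ (by positivity) h1 2)
    refine (mul_le_mul_of_nonneg_left h4 (norm_nonneg _)).trans (le_of_eq ?_)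
    field_simp
  · exact hint.norm.const_mul _
  · refine Filter.Eventually.of_forall fun t z hz => ?_
    have hne' := sq_sub_sq_ne_zero (hne z hz) t
    have h := ((hasDerivAt_id z).div
      (((hasDerivAt_id z).pow 2).const_sub ((t : ℂ) ^ 2)) hne').const_mul (σ t : ℂ)
    refine h.congr_deriv ?_
    simp only [id, Pi.pow_apply]
    congr 2
    push_cast
    ring

/-- From `2z / (t² - z²) = 1 / (t - z) - 1 / (t + z)`: the imaginary part symmetrizes the Poisson
kernel in `t`, which is invisible to even densities. -/
theorem im_schwarz_kernel {z : ℂ} (hz : z.im ≠ 0) (t : ℝ) :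
    (z / ((t : ℂ) ^ 2 - z ^ 2)).im =
      z.im / 2 * (1 / ((t - z.re) ^ 2 + z.im ^ 2) + 1 / ((-t - z.re) ^ 2 + z.im ^ 2)) := by
  have hy : 0 < z.im ^ 2 := by positivity
  have h1 : (t - z.re) ^ 2 + z.im ^ 2 ≠ 0 := by positivity
  have h2 : (-t - z.re) ^ 2 + z.im ^ 2 ≠ 0 := by positivity
  have hn : Complex.normSq ((t : ℂ) ^ 2 - z ^ 2) =
      ((t - z.re) ^ 2 + z.im ^ 2) * ((-t - z.re) ^ 2 + z.im ^ 2) := by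
    rw [show (t : ℂ) ^ 2 - z ^ 2 = ((t : ℂ) - z) * ((t : ℂ) + z) by ring, Complex.normSq_mul,
      Complex.normSq_apply, Complex.normSq_apply]
    simp
    ring
  rw [Complex.div_im, hn]
  simp only [sq, Complex.sub_re, Complex.sub_im, Complex.mul_re, Complex.mul_im,
    Complex.ofReal_re, Complex.ofReal_im] at h1 h2 ⊢
  field_simp
  ring

theorem integrable_poisson_kernel {σ : ℝ → ℝ} (hσ : Measurable σ)
    (hint : Integrable fun t => σ t / (1 + |t|) ^ 2) {z : ℂ} (hz : z.im ≠ 0) :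
    Integrable fun t : ℝ => σ t / ((t - z.re) ^ 2 + z.im ^ 2) := by
  have hz' := abs_pos.2 hz
  set c := |z.im| / (1 + ‖z‖ + |z.im|) with hc
  have hc0 : 0 < c := by positivity
  have h := integrable_mul_of_norm_le hσ hint
    (k := fun t : ℝ => ((1 / ((t - z.re) ^ 2 + z.im ^ 2) : ℝ) : ℂ)) (by fun_prop)
    (C := 1 / c ^ 2) fun t => by
      have h1 := mul_one_add_abs_le_norm_sub hz' le_rfl le_rfl (z := z) t
      have h2 : ‖(t : ℂ) - z‖ ^ 2 = (t - z.re) ^ 2 + z.im ^ 2 := by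
        rw [Complex.sq_norm, Complex.normSq_apply]
        simp
        ring
      rw [Complex.norm_real, norm_of_nonneg (by positivity), div_div, ← mul_pow, ← h2]
      exact div_le_div_of_nonneg_left zero_le_one (by positivity)
        (pow_le_pow_left₀ (by positivity) h1 2)
  refine h.re.congr (Filter.Eventually.of_forall fun t => ?_)
  simp only [← Complex.ofReal_mul, mul_one_div]
  exact Complex.ofReal_re _

theorem re_schwarzIntegral {σ : ℝ → ℝ} (hσ : Measurable fun t : ℝ => σ |t|)
    (hint : Integrable fun t : ℝ => σ |t| / (1 + |t|) ^ 2) {z : ℂ} (hz : 0 < z.im) :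
    (schwarzIntegral (fun t => σ |t|) z).re = harmonicExtension σ z := by
  have hk := integrable_schwarz_kernel hσ hint hz.ne'
  have hp := integrable_poisson_kernel hσ hint hz.ne'
  have hre : ∀ w : ℂ, (-Complex.I / π * w).re = w.im / π := fun w => by
    rw [show -Complex.I / (π : ℂ) * w = ((π⁻¹ : ℝ) : ℂ) * (-Complex.I * w) by push_cast; ring,
      Complex.re_ofReal_mul]
    simp
    ring
  have him : (∫ t : ℝ, ((σ |t| : ℝ) : ℂ) * (z / ((t : ℂ) ^ 2 - z ^ 2))).im =
      ∫ t : ℝ, (((σ |t| : ℝ) : ℂ) * (z / ((t : ℂ) ^ 2 - z ^ 2))).im :=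
    (integral_im hk).symm
  rw [schwarzIntegral, hre, him, harmonicExtension, if_neg hz.ne', abs_of_pos hz]
  have hcongr : ∀ t : ℝ, (((σ |t| : ℝ) : ℂ) * (z / ((t : ℂ) ^ 2 - z ^ 2))).im =
      z.im / 2 * (σ |t| / ((t - z.re) ^ 2 + z.im ^ 2) +
        σ |(-t)| / ((-t - z.re) ^ 2 + z.im ^ 2)) := fun t => by
    rw [Complex.im_ofReal_mul, im_schwarz_kernel hz.ne', abs_neg]
    ring
  simp_rw [hcongr]
  rw [integral_const_mul, integral_add hp hp.comp_neg,
    integral_neg_eq_self (fun t : ℝ => σ |t| / ((t - z.re) ^ 2 + z.im ^ 2))]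
  ring

/-- At `z = i y` the kernel is `i` times a real function, and the prefactor `-i / π` cancels that
`i`. -/
theorem im_schwarzIntegral_of_re_eq_zero (σ : ℝ → ℝ) {z : ℂ} (hz : z.re = 0) :
    (schwarzIntegral σ z).im = 0 := by
  obtain ⟨y, rfl⟩ : ∃ y : ℝ, z = y * Complex.I := ⟨z.im, by
    apply Complex.ext <;> simp [hz]⟩
  have h : ∀ t : ℝ, (σ t : ℂ) * (y * Complex.I / ((t : ℂ) ^ 2 - (y * Complex.I) ^ 2)) =
      Complex.I * ((σ t * (y / (t ^ 2 + y ^ 2)) : ℝ) : ℂ) := fun t => by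
    rw [mul_pow, Complex.I_sq]
    push_cast
    ring
  rw [schwarzIntegral]
  simp_rw [h]
  rw [integral_const_mul, integral_complex_ofReal, ← mul_assoc,
    show -Complex.I / (π : ℂ) * Complex.I = ((π⁻¹ : ℝ) : ℂ) by
      push_cast
      linear_combination (-(π : ℂ)⁻¹) * Complex.I_mul_I, ← Complex.ofReal_mul, Complex.ofReal_im]

/-! ### Poisson integral on the imaginary axis -/

theorem integrable_poisson_one (x : ℝ) {y : ℝ} (hy : 0 < y) :
    Integrable fun t : ℝ => 1 / ((t - x) ^ 2 + y ^ 2) := by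
  lift y to NNReal using hy.le
  have h := (ProbabilityTheory.integrable_cauchyPDFReal x (γ := y)).const_mul (π / y)
  refine h.congr (Filter.Eventually.of_forall fun t => ?_)
  have hp := pi_pos.ne'
  simp only [ProbabilityTheory.cauchyPDFReal]
  field_simp

theorem poisson_integral_one (x : ℝ) {y : ℝ} (hy : 0 < y) :
    y / π * ∫ t : ℝ, 1 / ((t - x) ^ 2 + y ^ 2) = 1 := by
  lift y to NNReal using hy.le
  rw [← integral_const_mul]
  refine Eq.trans ?_
    (ProbabilityTheory.integral_cauchyPDFReal_eq_one x (γ := y) (NNReal.coe_pos.1 hy).ne')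
  refine integral_congr_ae (Filter.Eventually.of_forall fun t => ?_)
  simp only [ProbabilityTheory.cauchyPDFReal]
  ring

/-- The substitution `t = y s` removes `y`, so the final constant is uniform along the axis. -/
theorem poisson_integral_rpow (β : ℝ) {y : ℝ} (hy : 0 < y) :
    y / π * ∫ t : ℝ, (1 + |t| / y) ^ β / (t ^ 2 + y ^ 2) =
      1 / π * ∫ s : ℝ, (1 + |s|) ^ β / (s ^ 2 + 1) := by
  have h : ∀ t : ℝ, (1 + |t| / y) ^ β / (t ^ 2 + y ^ 2) =
      1 / y ^ 2 * ((1 + |t / y|) ^ β / ((t / y) ^ 2 + 1)) := fun t => by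
    rw [abs_div, abs_of_pos hy]
    field_simp
  simp_rw [h]
  rw [integral_const_mul, Measure.integral_comp_div (fun s : ℝ => (1 + |s|) ^ β / (s ^ 2 + 1)) y,
    abs_of_pos hy, smul_eq_mul]
  field_simp

theorem integrable_poisson_rpow {β : ℝ} (hβ : β < 1) {y : ℝ} (hy : 0 < y) :
    Integrable fun t : ℝ => (1 + |t| / y) ^ β / (t ^ 2 + y ^ 2) := by
  have h1 := integrable_poisson_kernel (σ := fun t => (1 + |t|) ^ β) (by fun_prop)
    (integrable_one_add_abs_rpow hβ) (z := Complex.I) (by simp)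
  refine ((h1.comp_div hy.ne').const_mul (1 / y ^ 2)).congr
    (Filter.Eventually.of_forall fun t => ?_)
  simp only [Complex.I_re, Complex.I_im, sub_zero, one_pow, abs_div, abs_of_pos hy]
  field_simp

/-- On the imaginary axis, the Poisson integral of `ω_M` is bounded by a single dilated term. -/
theorem exists_harmonicExtension_le_logTerm {M : ℕ → ℝ} (hM : IsWeightSequence M)
    (hγ : 1 < gammaIndex M) :
    ∃ C : ℝ, ∀ z : ℂ, z.re = 0 → 0 < z.im → ∃ q : ℕ,
      harmonicExtension (omega M) z ≤ logTerm M q z.im + C * ((q : ℝ) + 1) := by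
  obtain ⟨β, C, hβ, hβ1, hC, h⟩ := exists_omega_growth hM hγ
  refine ⟨C * (1 / π * ∫ s : ℝ, (1 + |s|) ^ β / (s ^ 2 + 1)), fun z hre hy => ?_⟩
  obtain ⟨q, hq⟩ := h z.im hy
  refine ⟨q, ?_⟩
  rw [harmonicExtension, if_neg hy.ne', abs_of_pos hy, ← poisson_integral_rpow β hy]
  have hσ : Measurable fun t : ℝ => omega M |t| := (measurable_omega M).comp measurable_norm
  have hI := integrable_poisson_kernel hσ (integrable_omega_weighted hM hγ) hy.ne'
  have hK := (integrable_poisson_one z.re hy).const_mul (logTerm M q z.im)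
  have hR := (integrable_poisson_rpow hβ1 hy).const_mul (C * ((q : ℝ) + 1))
  have hmono := integral_mono hI (hK.add hR) fun t => by
    have h1 := div_le_div_of_nonneg_right (hq |t| (abs_nonneg t))
      (show 0 ≤ t ^ 2 + z.im ^ 2 by positivity)
    simp only [Pi.add_apply, hre, sub_zero]
    refine h1.trans (le_of_eq ?_)
    ring
  rw [integral_add' hK hR, integral_const_mul, integral_const_mul] at hmono
  have hmul := mul_le_mul_of_nonneg_left hmono (div_nonneg hy.le pi_pos.le)
  refine hmul.trans (le_of_eq ?_)
  have h1 := poisson_integral_one z.re hy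
  linear_combination (logTerm M q z.im) * h1

/-! ### Lower bound for the Poisson integral -/

theorem integral_log_sub_log {r : ℝ} (hr : 0 < r) :
    ∫ t in (-(r / 4))..(r / 4), (log t - log r) = -(r / 2 * (log 4 + 1)) := by
  rw [intervalIntegral.integral_sub intervalIntegral.intervalIntegrable_log'
    intervalIntegrable_const, integral_log, intervalIntegral.integral_const, log_neg_eq_log,
    log_div hr.ne' four_ne_zero, smul_eq_mul]
  ring

theorem log_abs_ge {r : ℝ} (hr : 0 < r) (t : ℝ) :
    log r - log 4 + (Set.Ioc (-(r / 4)) (r / 4)).indicator (fun t => log t - log r) t ≤ log t := by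
  have h4 : 0 ≤ log 4 := log_nonneg (by norm_num)
  by_cases hmem : t ∈ Set.Ioc (-(r / 4)) (r / 4)
  · rw [Set.indicator_of_mem hmem]
    linarith
  · rw [Set.indicator_of_notMem hmem, add_zero, ← log_div hr.ne' four_ne_zero, ← log_abs t]
    refine log_le_log (by positivity) ?_
    by_contra hlt
    rw [not_le, abs_lt] at hlt
    exact hmem ⟨hlt.1, hlt.2.le⟩

/-- For `|t| ≤ ‖z‖ / 4` the kernel is at most `16 / (9 ‖z‖²) ≤ 2 / ‖z‖²`, and it multiplies a
nonpositive quantity. The point `t = 0` is excluded because `log 0 = 0` by convention. -/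
theorem indicator_log_mul_poisson_ge {z : ℂ} (hz : 0 < z.im) {t : ℝ} (ht : t ≠ 0) :
    2 / ‖z‖ ^ 2 *
        (Set.Ioc (-(‖z‖ / 4)) (‖z‖ / 4)).indicator (fun t => log t - log ‖z‖) t ≤
      (Set.Ioc (-(‖z‖ / 4)) (‖z‖ / 4)).indicator (fun t => log t - log ‖z‖) t *
        (1 / ((t - z.re) ^ 2 + z.im ^ 2)) := by
  have hr : 0 < ‖z‖ := norm_pos_iff.2 fun h => by simp [h] at hz
  by_cases hmem : t ∈ Set.Ioc (-(‖z‖ / 4)) (‖z‖ / 4)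
  · have habs : |t| ≤ ‖z‖ / 4 := abs_le.2 ⟨hmem.1.le, hmem.2⟩
    have hneg : log t - log ‖z‖ ≤ 0 := by
      rw [← log_abs t, sub_nonpos]
      exact log_le_log (abs_pos.2 ht) (by linarith)
    have h2 : ‖(t : ℂ) - z‖ ^ 2 = (t - z.re) ^ 2 + z.im ^ 2 := by
      rw [Complex.sq_norm, Complex.normSq_apply]
      simp
      ring
    have h3 : 3 / 4 * ‖z‖ ≤ ‖(t : ℂ) - z‖ := by
      have := norm_sub_norm_le z (t : ℂ)
      rw [Complex.norm_real, norm_eq_abs, norm_sub_rev] at this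
      linarith
    have hk : 1 / ((t - z.re) ^ 2 + z.im ^ 2) ≤ 2 / ‖z‖ ^ 2 := by
      rw [← h2, div_le_div_iff₀ (pow_pos (by linarith) 2) (by positivity)]
      nlinarith
    rw [Set.indicator_of_mem hmem, mul_comm]
    exact mul_le_mul_of_nonpos_left hk hneg
  · simp [Set.indicator_of_notMem hmem]

/-- The Poisson integral of `ω_M` dominates every term, up to a fixed dilation. -/
theorem logTerm_sub_le_harmonicExtension {M : ℕ → ℝ} (hM : IsWeightSequence M)
    (hγ : 1 < gammaIndex M) {z : ℂ} (hz : 0 < z.im) (p : ℕ) :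
    logTerm M p ‖z‖ - p * (2 * log 4 + 1) ≤ harmonicExtension (omega M) z := by
  have hr : 0 < ‖z‖ := norm_pos_iff.2 fun h => by simp [h] at hz
  set r := ‖z‖ with hrdef
  set L : ℝ → ℝ := (Set.Ioc (-(r / 4)) (r / 4)).indicator (fun t => log t - log r) with hL
  have hle : -(r / 4) ≤ r / 4 := by linarith
  have hLint : Integrable L := by
    rw [hL, integrable_indicator_iff measurableSet_Ioc,
      ← intervalIntegrable_iff_integrableOn_Ioc_of_le hle]
    exact intervalIntegral.intervalIntegrable_log'.sub intervalIntegrable_const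
  have hLval : ∫ t, L t = -(r / 2 * (log 4 + 1)) := by
    rw [hL, integral_indicator measurableSet_Ioc, ← intervalIntegral.integral_of_le hle,
      integral_log_sub_log hr]
  have hσ : Measurable fun t : ℝ => omega M |t| := (measurable_omega M).comp measurable_norm
  have hI := integrable_poisson_kernel hσ (integrable_omega_weighted hM hγ) hz.ne'
  have hK := (integrable_poisson_one z.re hz).const_mul (logTerm M p r - p * log 4)
  have hR := hLint.const_mul (p * (2 / r ^ 2))
  have hmono := integral_mono_ae (hK.add hR) hI <| by
    refine (Measure.ae_ne volume (0 : ℝ)).mono fun t ht0 => ?_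
    have h1 := logTerm_le_omega hM hγ p (abs_pos.2 ht0)
    have h2 := mul_le_mul_of_nonneg_left (log_abs_ge hr t) p.cast_nonneg (α := ℝ)
    have h3 := mul_le_mul_of_nonneg_left (indicator_log_mul_poisson_ge hz ht0)
      p.cast_nonneg (α := ℝ)
    rw [← hrdef, ← hL] at h3
    rw [← hL] at h2
    rw [logTerm, log_abs] at h1
    have hk : 0 ≤ 1 / ((t - z.re) ^ 2 + z.im ^ 2) := by positivity
    have h4 : logTerm M p r - p * log 4 + p * L t ≤ omega M |t| := by
      rw [logTerm]
      linarith
    have h5 := mul_le_mul_of_nonneg_right h4 hk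
    simp only [Pi.add_apply]
    rw [div_eq_mul_one_div (omega M |t|)]
    linarith
  rw [integral_add' hK hR, integral_const_mul, integral_const_mul, hLval] at hmono
  rw [harmonicExtension, if_neg hz.ne', abs_of_pos hz]
  have hmul := mul_le_mul_of_nonneg_left hmono (div_nonneg hz.le pi_pos.le)
  refine le_trans ?_ hmul
  have h1 := poisson_integral_one z.re hz
  have h4 : 0 ≤ log 4 := log_nonneg (by norm_num)
  -- The logarithmic singularity costs `p (log 4 + 1)` times this factor; with the `p log 4` from
  -- the cutoff at `r / 4` the total is `p (2 log 4 + 1)`.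
  have hyr : z.im / (π * r) ≤ 1 := by
    rw [div_le_one (by positivity)]
    have := (le_abs_self z.im).trans (Complex.abs_im_le_norm z)
    nlinarith [pi_gt_three]
  have e : z.im / π * ((logTerm M p r - p * log 4) * (∫ t : ℝ, 1 / ((t - z.re) ^ 2 + z.im ^ 2)) +
      p * (2 / r ^ 2) * -(r / 2 * (log 4 + 1))) =
      logTerm M p r - p * log 4 - p * (log 4 + 1) * (z.im / (π * r)) := by
    rw [mul_add, show z.im / π * (p * (2 / r ^ 2) * -(r / 2 * (log 4 + 1))) =
      -(p * (log 4 + 1) * (z.im / (π * r))) by field_simp]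
    linear_combination (logTerm M p r - p * log 4) * h1
  rw [e]
  have := mul_le_mul_of_nonneg_left hyr (show 0 ≤ p * (log 4 + 1) by positivity)
  linarith

/-! ### Harmonic conjugates -/

theorem isOpen_upperHalf : IsOpen upperHalf := isOpen_lt continuous_const Complex.continuous_im

theorem isPreconnected_upperHalf : IsPreconnected upperHalf :=
  (convex_halfSpace_im_gt 0).isPreconnected

theorem differentiableOn_schwarzIntegral_omega {M : ℕ → ℝ} (hM : IsWeightSequence M)
    (hγ : 1 < gammaIndex M) :
    DifferentiableOn ℂ (schwarzIntegral fun t => omega M |t|) upperHalf := fun _ hz =>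
  (differentiableAt_schwarzIntegral ((measurable_omega M).comp measurable_norm)
    (integrable_omega_weighted hM hγ) hz).differentiableWithinAt

theorem re_schwarzIntegral_omega {M : ℕ → ℝ} (hM : IsWeightSequence M)
    (hγ : 1 < gammaIndex M) {z : ℂ} (hz : z ∈ upperHalf) :
    (schwarzIntegral (fun t => omega M |t|) z).re = harmonicExtension (omega M) z :=
  re_schwarzIntegral ((measurable_omega M).comp measurable_norm)
    (integrable_omega_weighted hM hγ) hz

theorem exists_harmonicConjugate {M : ℕ → ℝ} (hM : IsWeightSequence M)
    (hγ : 1 < gammaIndex M) :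
    ∃ Q : ℂ → ℝ, IsHarmonicConjugateOn (harmonicExtension (omega M)) Q upperHalf ∧
      Q Complex.I = 0 := by
  refine ⟨fun z => (schwarzIntegral (fun t => omega M |t|) z).im, ?_,
    im_schwarzIntegral_of_re_eq_zero _ Complex.I_re⟩
  refine (differentiableOn_schwarzIntegral_omega hM hγ).congr fun z hz => ?_
  rw [← re_schwarzIntegral_omega hM hγ hz, mul_comm, Complex.re_add_im]

/-- Two holomorphic functions on a preconnected open set with the same real part, which agree
at a point, have the same exponential. -/
theorem exp_neg_eqOn_of_re_eq {U : Set ℂ} (hU : IsOpen U) (hc : IsPreconnected U) {f g : ℂ → ℂ}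
    (hf : DifferentiableOn ℂ f U) (hg : DifferentiableOn ℂ g U)
    (hre : ∀ z ∈ U, (f z).re = (g z).re) {c : ℂ} (hcU : c ∈ U) (hfg : f c = g c) :
    ∀ z ∈ U, Complex.exp (-f z) = Complex.exp (-g z) := by
  have hnorm : ∀ z ∈ U, ‖Complex.exp (g z - f z)‖ = 1 := fun z hz => by
    rw [Complex.norm_exp, Complex.sub_re, hre z hz, sub_self, Real.exp_zero]
  -- `exp (g - f)` has modulus one, hence maximal modulus at `c`; the maximum principle makes it
  -- constant.
  have h := Complex.eqOn_of_isPreconnected_of_isMaxOn_norm hc hU (hg.sub hf).cexp hcU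
    fun z hz => by
      simp only [Set.mem_ofPred_eq, Function.comp_apply, Pi.sub_apply]
      rw [hnorm z hz, hnorm c hcU]
  intro z hz
  have h1 := h hz
  simp only [Pi.sub_apply, Function.const_apply, hfg, sub_self, Complex.exp_zero] at h1
  rw [show -f z = -g z + (g z - f z) by ring, Complex.exp_add, h1, mul_one]

/-! ### The flat function -/

theorem mem_sector_one_iff {z : ℂ} : z ∈ sector 1 ↔ 0 < z.re := by
  rw [sector, Set.mem_ofPred_eq, one_mul, Complex.abs_arg_lt_pi_div_two_iff]
  constructor
  · rintro ⟨h0, h | h⟩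
    exacts [h, absurd h h0]
  · exact fun h => ⟨fun h0 => by simp [h0] at h, Or.inl h⟩

theorem I_div_mem_upperHalf {z : ℂ} (hz : 0 < z.re) : Complex.I / z ∈ upperHalf := by
  have h0 : z ≠ 0 := fun h => by simp [h] at hz
  have : (Complex.I / z).im = z.re / Complex.normSq z := by simp [Complex.div_im]
  rw [upperHalf, Set.mem_ofPred_eq, this]
  exact div_pos hz (Complex.normSq_pos.2 h0)

theorem h_le {M : ℕ → ℝ} (hM : ∀ p, 0 < M p) {t : ℝ} (ht : 0 ≤ t) (p : ℕ) :
    h M t ≤ M p * t ^ p :=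
  ciInf_le ⟨0, by rintro _ ⟨n, rfl⟩; exact mul_nonneg (hM n).le (pow_nonneg ht n)⟩ p

theorem norm_flatFun (M : ℕ → ℝ) (Q : ℂ → ℝ) (z : ℂ) :
    ‖flatFun M Q z‖ = exp (-harmonicExtension (omega M) (Complex.I / z)) := by
  rw [flatFun, Complex.norm_exp]
  simp

theorem norm_flatFun_le {M : ℕ → ℝ} (hM : IsWeightSequence M) (hγ : 1 < gammaIndex M)
    (Q : ℂ → ℝ) {z : ℂ} (hz : 0 < z.re) :
    ‖flatFun M Q z‖ ≤ h M (exp (2 * log 4 + 1) * ‖z‖) := by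
  have hz0 : 0 < ‖z‖ := norm_pos_iff.2 fun h => by simp [h] at hz
  rw [norm_flatFun]
  refine le_ciInf fun p => ?_
  have h1 := logTerm_sub_le_harmonicExtension hM hγ (I_div_mem_upperHalf hz) p
  have hw : ‖Complex.I / z‖ = ‖z‖⁻¹ := by rw [norm_div, Complex.norm_I, one_div]
  rw [hw] at h1
  calc exp (-harmonicExtension (omega M) (Complex.I / z))
      ≤ exp (-logTerm M p ‖z‖⁻¹ + p * (2 * log 4 + 1)) := exp_le_exp.2 (by linarith)
    _ = M p * (exp (2 * log 4 + 1) * ‖z‖) ^ p := by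
      rw [exp_add, exp_neg_logTerm hM.pos p (inv_pos.2 hz0), inv_inv, exp_nat_mul, mul_pow]
      ring

theorem exists_h_le_exp_neg_harmonicExtension {M : ℕ → ℝ} (hM : IsWeightSequence M)
    (hγ : 1 < gammaIndex M) :
    ∃ K₁ K₂ : ℝ, 0 < K₁ ∧ 0 < K₂ ∧ ∀ x : ℝ, 0 < x →
      K₁ * h M (K₂ * x) ≤ exp (-harmonicExtension (omega M) (Complex.I / x)) := by
  obtain ⟨C, hC⟩ := exists_harmonicExtension_le_logTerm hM hγ
  -- In the error `C (q + 1)`, the summand `C` becomes the prefactor and `C q` the dilation.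
  refine ⟨exp (-C), exp (-C), exp_pos _, exp_pos _, fun x hx => ?_⟩
  have hw : Complex.I / (x : ℂ) = ((x⁻¹ : ℝ) : ℂ) * Complex.I := by push_cast; ring
  obtain ⟨q, hq⟩ := hC (Complex.I / x) (by simp [hw]) (by simpa [hw] using hx)
  have him : (Complex.I / (x : ℂ)).im = x⁻¹ := by rw [hw]; simp
  rw [him] at hq
  calc exp (-C) * h M (exp (-C) * x) ≤ exp (-C) * (M q * (exp (-C) * x) ^ q) :=
        mul_le_mul_of_nonneg_left (h_le hM.pos (by positivity) q) (exp_pos _).le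
    _ = exp (-logTerm M q x⁻¹ + (q * -C + -C)) := by
        rw [exp_add, exp_add, exp_neg_logTerm hM.pos q (inv_pos.2 hx), inv_inv, exp_nat_mul,
          mul_pow]
        ring
    _ ≤ _ := exp_le_exp.2 (by linarith)

theorem differentiableOn_flatFun {M : ℕ → ℝ} {Q : ℂ → ℝ}
    (hQ : IsHarmonicConjugateOn (harmonicExtension (omega M)) Q upperHalf) :
    DifferentiableOn ℂ (flatFun M Q) (sector 1) := by
  have h1 : DifferentiableOn ℂ (fun z : ℂ => Complex.I / z) (sector 1) := fun z hz =>
    ((differentiableAt_const _).div differentiableAt_id hz.1).differentiableWithinAt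
  have h2 := (hQ.comp h1 fun z hz => I_div_mem_upperHalf (mem_sector_one_iff.1 hz)).neg.cexp
  refine h2.congr fun z _ => ?_
  simp only [flatFun, Pi.neg_apply, Function.comp_apply, neg_add, sub_eq_add_neg]

/-- The point `i / x` lies on the imaginary axis, where the Schwarz integral is real, and the
normalization at `i` identifies the two exponentials. -/
theorem flatFun_ofReal {M : ℕ → ℝ} (hM : IsWeightSequence M) (hγ : 1 < gammaIndex M) {Q : ℂ → ℝ}
    (hQ : IsHarmonicConjugateOn (harmonicExtension (omega M)) Q upperHalf)
    (hQI : Q Complex.I = 0) {x : ℝ} (hx : 0 < x) :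
    flatFun M Q x = (exp (-harmonicExtension (omega M) (Complex.I / x)) : ℝ) := by
  have hmem : Complex.I / (x : ℂ) ∈ upperHalf := I_div_mem_upperHalf (by simpa using hx)
  have hI : Complex.I ∈ upperHalf := by simp [upperHalf]
  have hreal : ∀ z ∈ upperHalf, z.re = 0 → schwarzIntegral (fun t => omega M |t|) z =
      (harmonicExtension (omega M) z : ℂ) := fun z hz hre => by
    apply Complex.ext
    · rw [re_schwarzIntegral_omega hM hγ hz, Complex.ofReal_re]
    · rw [im_schwarzIntegral_of_re_eq_zero _ hre, Complex.ofReal_im]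
  have h := exp_neg_eqOn_of_re_eq isOpen_upperHalf isPreconnected_upperHalf hQ
    (differentiableOn_schwarzIntegral_omega hM hγ)
    (fun z hz => by rw [re_schwarzIntegral_omega hM hγ hz]; simp) hI
    (by rw [hreal _ hI Complex.I_re, hQI]; simp) _ hmem
  rw [hreal _ hmem (by simp [Complex.div_re])] at h
  rw [flatFun, sub_eq_add_neg, ← neg_add, h]
  push_cast
  rfl

theorem isOptimalFlat_flatFun {M : ℕ → ℝ} (hM : IsWeightSequence M) (hγ : 1 < gammaIndex M)
    {Q : ℂ → ℝ} (hQ : IsHarmonicConjugateOn (harmonicExtension (omega M)) Q upperHalf)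
    (hQI : Q Complex.I = 0) : IsOptimalFlat M (sector 1) (flatFun M Q) where
  holomorphic := differentiableOn_flatFun hQ
  lower := by
    obtain ⟨K₁, K₂, h₁, h₂, hle⟩ := exists_h_le_exp_neg_harmonicExtension hM hγ
    refine ⟨K₁, K₂, h₁, h₂, fun x hx => ?_⟩
    rw [flatFun_ofReal hM hγ hQ hQI hx]
    exact ⟨Complex.ofReal_im _, by simpa only [Complex.ofReal_re] using hle x hx⟩
  upper := ⟨1, exp (2 * log 4 + 1), one_pos, exp_pos _, fun z hz => by
    rw [one_mul]
    exact norm_flatFun_le hM hγ Q (mem_sector_one_iff.1 hz)⟩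

end OptimalFlat

end

theorem mainTheorem4 (M : ℕ → ℝ) (hM : OptimalFlat.IsWeightSequence M)
    (hγ : 1 < OptimalFlat.gammaIndex M) :
    OptimalFlat.IsNonquasianalytic (OptimalFlat.omega M) ∧
    (∃ Q : ℂ → ℝ,
      OptimalFlat.IsHarmonicConjugateOn
        (OptimalFlat.harmonicExtension (OptimalFlat.omega M)) Q OptimalFlat.upperHalf ∧
      Q Complex.I = 0) ∧
    ∀ Q : ℂ → ℝ,
      OptimalFlat.IsHarmonicConjugateOn
        (OptimalFlat.harmonicExtension (OptimalFlat.omega M)) Q OptimalFlat.upperHalf →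
      Q Complex.I = 0 →
      OptimalFlat.IsOptimalFlat M (OptimalFlat.sector 1) (OptimalFlat.flatFun M Q) := by
  exact ⟨OptimalFlat.isNonquasianalytic_omega hM hγ, OptimalFlat.exists_harmonicConjugate hM hγ,
    fun _ hQ hQI => OptimalFlat.isOptimalFlat_flatFun hM hγ hQ hQI⟩
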